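/- **Setting.** Let $\Pi$ be a finite non-empty decision space, let rewards take values in $[0,1]$, and let $\mathcal{O}$ be a measurable observation space. A *model* is a map $M:\Pi\to\Delta([0,1]\times\mathcal{O})$ into probability distributions; write $f^M(\pi)=\mathbb{E}_{(r,o)\sim M(\pi)}[r]$ and $\pi_M\in\arg\max_{\pi\in\Pi}f^M(\pi)$. Let $\mathcal{M}$ be a class of models and $\mathrm{co}(\mathcal{M})$ the set of all its finitely supported mixtures. In each round $t=1,\dots,T$, the adversary picks $M^{(t)}\in\mathcal{M}$ (possibly depending measurably on the history of the previous rounds; the adversary is *oblivious* if it does not), the algorithm draws $\pi^{(t)}\sim p^{(t)}$, where $p^{(t)}$ is a probability kernel from the history of the previous rounds to $\Pi$, and $(r^{(t)},o^{(t)})\sim M^{(t)}(\pi^{(t)})$ is observed. The regret is $$\mathrm{Reg}=\sup_{\pi^\star\in\Pi}\sum_{t=1}^T\mathbb{E}_{\pi^{(t)}\sim p^{(t)}}\big[f^{M^{(t)}}(\pi^\star)-f^{M^{(t)}}(\pi^{(t)})\big].$$ The algorithm is *sub-Chebychev with parameter $R$* against a family of adversaries if $\mathbb{P}\big((\mathrm{Reg})_+\ge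 x\big)\le R^2/x^2$ for all $x>0$ and every adversary in the family, where $(y)_+=\max\{y,0\}$. **Complexity.** With the squared Hellinger distance $D_H^2(P,Q)=\int(\sqrt{dP/d\nu}-\sqrt{dQ/d\nu})^2d\nu$ ($\nu$ any common dominating measure), let, for a class $\mathcal{N}$ of models, a model $\overline M$, $\gamma>0$ and $\varepsilon>0$, $$\mathsf{dec}_\gamma(\mathcal{N},\overline M)=\inf_{p\in\Delta(\Pi)}\sup_{M\in\mathcal{N}}\mathbb{E}_{\pi\sim p}\big[f^M(\pi_M)-f^M(\pi)-\gamma D_H^2(M(\pi),\overline M(\pi))\big],$$ $$\mathcal{N}_\varepsilon(\overline M)=\{M\in\mathcal{N}: f^{\overline M}(\pi_{\overline M})\ge f^M(\pi_M)-\varepsilon\},\qquad \mathsf{dec}_{\gamma,\varepsilon}(\mathcal{N})=\sup_{\overline M\in\mathcal{N}}\mathsf{dec}_\gamma(\mathcal{N}_\varepsilon(\overline M),\overline M).$$ Let $V(\mathcal{M})=\max\big\{e,\ \sup_{M,M'\in\mathcal{M}}\sup_{\pi\in\Pi}\sup_{A}\tfrac{M(A\mid\pi)}{M'(A\mid\pi)}\big\}\in[e,\infty]$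 ($A$ ranges over measurable events; $x/0=\infty$ for $x>0$ and $0/0=0$). For a constant $c>0$ put $C(T)=c\log\min\{T,V(\mathcal{M})\}$ and $\varepsilon_\gamma=\frac{\gamma}{4C(T)T}$. **Statement.** There are numerical constants $c_0,a,K>0$ and $k\in\mathbb{N}$ such that for all $\Pi,\mathcal{O},\mathcal{M}$ as above, all $c\ge c_0$, all $T\ge2$ and all $R>0$: every algorithm that is sub-Chebychev with parameter $R$ over $T$ rounds, against a family of adversaries that includes all oblivious ones in $\mathcal{M}$ (for instance against all adaptive adversaries), satisfies $$R\ \ge\ \frac{a}{(\log T)^k}\cdot\sup_{\gamma>\sqrt{2C(T)T}}\mathsf{dec}_{\gamma,\varepsilon_\gamma}(\mathrm{co}(\mathcal{M}))\cdot T\ -\ K\sqrt{T}.$$ -/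

import Mathlib

open MeasureTheory ProbabilityTheory
open scoped ENNReal NNReal

universe u v

noncomputable section

namespace DMSO

/-- What the learner receives in a round: a reward in `[0,1]` and an observation in `O`. -/
abbrev Outcome (O : Type v) : Type v := unitInterval × O

/-- A model maps each decision in `D` to a probability distribution over rewards and
observations.  (For a finite discrete decision space this is the same as a probability kernel
from `D` to `[0,1] × O`.) -/
abbrev Model (D : Type u) (O : Type v) [MeasurableSpace O] : Type (max u v) :=
  D → ProbabilityMeasure (Outcome O)

/-- Histories of `t` rounds: sequences `(π₁, (r₁, o₁)), …, (π_t, (r_t, o_t))`. -/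
abbrev History (D : Type u) (O : Type v) (t : ℕ) : Type (max u v) :=
  Fin t → D × Outcome O

section Models

variable {D : Type u} {O : Type v} [MeasurableSpace O]

/-- The mean reward `f^M(π) = E^{M,π}[r]`. -/
def Model.meanReward (M : Model D O) (π : D) : ℝ :=
  ∫ z, (z.1 : ℝ) ∂(M π : Measure (Outcome O))

/-- The optimal mean reward `f^M(π_M) = max_π f^M(π)`. -/
def Model.optReward (M : Model D O) : ℝ := ⨆ π : D, M.meanReward π

/-- Squared Hellinger distance `∫ (√(dP/dν) - √(dQ/dν))² dν`, with the common dominating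
measure `ν = P + Q` (the value does not depend on the choice of `ν`). -/
def sqHellinger {X : Type*} [MeasurableSpace X] (P Q : Measure X) : ℝ :=
  ∫ x, (√((P.rnDeriv (P + Q) x).toReal) - √((Q.rnDeriv (P + Q) x).toReal)) ^ 2 ∂(P + Q)

/-- The convex hull `co(ℳ)`: all finitely supported mixtures of models in `ℳ`. -/
def convHull (ℳ : Set (Model D O)) : Set (Model D O) :=
  {M | ∃ (n : ℕ) (w : Fin n → ℝ≥0) (N : Fin n → Model D O),
    (∀ i, N i ∈ ℳ) ∧ ∑ i, w i = 1 ∧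
      ∀ π, (M π : Measure (Outcome O)) = ∑ i, w i • (N i π : Measure (Outcome O))}

/-- The localized class `ℳ_ε(M̄) = {M ∈ ℳ : f^M̄(π_M̄) ≥ f^M(π_M) - ε}`. -/
def localized (ℳ : Set (Model D O)) (ε : ℝ) (Mbar : Model D O) : Set (Model D O) :=
  {M ∈ ℳ | M.optReward - ε ≤ Mbar.optReward}

/-- The Decision-Estimation Coefficient with reference model `M̄`:
`inf_{p ∈ Δ(Π)} sup_{M ∈ ℳ} E_{π∼p}[f^M(π_M) - f^M(π) - γ D²_H(M(π), M̄(π))]`. -/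
def dec [MeasurableSpace D] (γ : ℝ) (ℳ : Set (Model D O)) (Mbar : Model D O) : EReal :=
  ⨅ p : ProbabilityMeasure D, ⨆ M ∈ ℳ,
    ((∫ π, (M.optReward - M.meanReward π -
      γ * sqHellinger (M π : Measure (Outcome O)) (Mbar π : Measure (Outcome O)))
        ∂(p : Measure D) : ℝ) : EReal)

/-- The localized Decision-Estimation Coefficient
`dec_{γ,ε}(ℳ) = sup_{M̄ ∈ ℳ} dec_γ(ℳ_ε(M̄), M̄)`. -/
def locDec [MeasurableSpace D] (γ ε : ℝ) (ℳ : Set (Model D O)) : EReal :=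
  ⨆ Mbar ∈ ℳ, dec γ (localized ℳ ε Mbar) Mbar

/-- `V(ℳ) = sup_{M,M' ∈ ℳ} sup_π sup_A {M(A ∣ π) / M'(A ∣ π)} ∨ e`, in `[e, ∞]`, over measurable
events `A`; here `x / 0 = ∞` for `x > 0`, and `0 / 0 = 0`. -/
def densityRatio (ℳ : Set (Model D O)) : ℝ≥0∞ :=
  (⨆ M ∈ ℳ, ⨆ M' ∈ ℳ, ⨆ π : D, ⨆ A : {A : Set (Outcome O) // MeasurableSet A},
    (M π : Measure (Outcome O)) A.1 / (M' π : Measure (Outcome O)) A.1)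
    ⊔ ENNReal.ofReal (Real.exp 1)

/-- `C(T) = c · log(T ∧ V(ℳ))`. -/
def logFactor (c : ℝ) (ℳ : Set (Model D O)) (T : ℕ) : ℝ :=
  c * Real.log (min (T : ℝ≥0∞) (densityRatio ℳ)).toReal

end Models

section Interaction

variable (D : Type u) (O : Type v) [MeasurableSpace D] [MeasurableSpace O]

/-- An algorithm: for each round (rounds are counted from `0`), a probability kernel from the
histories of the previous rounds to decisions. -/
structure Algorithm where
  policy : ∀ t : ℕ, Kernel (History D O t) D
  isMarkov : ∀ t, IsMarkovKernel (policy t)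

/-- An adaptive adversary: in each round it picks a model as a function of the history of the
previous rounds. -/
structure Adversary where
  model : ∀ t : ℕ, History D O t → Model D O
  measurable : ∀ t : ℕ, Measurable fun x : History D O t × D =>
    (model t x.1 x.2 : Measure (Outcome O))

variable {D O}

/-- The adversary only uses models in `ℳ`. -/
def Adversary.IsIn (adv : Adversary D O) (ℳ : Set (Model D O)) : Prop :=
  ∀ t h, adv.model t h ∈ ℳ

/-- The adversary is oblivious: its models do not depend on the history. -/
def Adversary.IsOblivious (adv : Adversary D O) : Prop :=
  ∀ t h h', adv.model t h = adv.model t h'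

/-- The conditional law of the outcome of a round, given the previous rounds and the decision. -/
def Adversary.kernel (adv : Adversary D O) (t : ℕ) :
    Kernel (History D O t × D) (Outcome O) where
  toFun x := (adv.model t x.1 x.2 : Measure (Outcome O))
  measurable' := adv.measurable t

/-- The law of the history of the first `t` rounds: in each round the decision is drawn from the
algorithm's policy and then the outcome from the adversary's model at that decision. -/
def law (alg : Algorithm D O) (adv : Adversary D O) : ∀ t : ℕ, Measure (History D O t)
  | 0 => Measure.dirac Fin.elim0
  | t + 1 => (law alg adv t ⊗ₘ (alg.policy t ⊗ₖ adv.kernel t)).map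
      fun x => Fin.snoc (α := fun _ => D × Outcome O) x.1 x.2

/-- The part of a history of `T` rounds that precedes round `t`. -/
def past {T : ℕ} (h : History D O T) (t : Fin T) : History D O t :=
  fun i => h (Fin.castLE t.2.le i)

/-- Regret to the best fixed decision in hindsight,
`sup_{π⋆} ∑_t E_{π_t ∼ p_t}[f^{M_t}(π⋆) - f^{M_t}(π_t)]`, as a function of the history. -/
def regret (alg : Algorithm D O) (adv : Adversary D O) (T : ℕ) (h : History D O T) : ℝ :=
  ⨆ πstar : D, ∑ t : Fin T, ∫ π, ((adv.model t (past h t)).meanReward πstar -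
    (adv.model t (past h t)).meanReward π) ∂(alg.policy t (past h t))

/-- The algorithm is sub-Chebychev with parameter `R` over `T` rounds against the adversaries in
`𝒜`: `P((Reg)₊ ≥ x) ≤ R² / x²` for all `x > 0`. -/
def IsSubChebychev (𝒜 : Set (Adversary D O)) (T : ℕ) (alg : Algorithm D O) (R : ℝ) : Prop :=
  ∀ adv ∈ 𝒜, ∀ x : ℝ, 0 < x →
    (law alg adv T).real {h | x ≤ max (regret alg adv T h) 0} ≤ R ^ 2 / x ^ 2

end Interaction

end DMSO

end

noncomputable section

set_option linter.unusedSectionVars false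

/-! The learner's own play is the witness in the DEC. Fix `Mbar` in the convex hull, let the
algorithm face `Mbar` in every round, and let `p` be the time-averaged law of its decisions. It is
enough that `T` times the `p`-mean of `g - γ d` is at most `8 R + √T` for every localized `M`; here
`g` is the gap of `M`, `gbar` that of `Mbar`, and `d π` the squared Hellinger distance of `M π` and
`Mbar π`.

Two facts carry this. First, integrating the Chebychev tail bounds the mean regret to a fixed
decision by `2 R` against every oblivious sequence from `ℳ`. That mean is affine in the model of
each round, so the bound extends to mixtures (`meanRegret_convHull_le`), and the cumulative gap is
at most `2 R` under both `M` and `Mbar` (`cumMean_gap_le`).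

Second, the gap of `M` must be moved from the law under `Mbar` to the law under `M`. With
likelihoods `u`, `v` of a history, either `u ≤ 3 v`, or `u` is at most three times the triangular
discrimination `(u - v)² / (u + v)`. The integral of the latter is at most `8 H`, where `H` is the
cumulative mean of `d` under `Mbar`: its affinity `u v / (u + v)` has a chain rule with a constant
loss per round (`le_integral_halfHarmonic_weight`), so no logarithm arises. Since the gap is
unbounded at the scale needed, it is split by localization as `g ≤ ε + gbar + γ / 2 * d + 2 / γ`;
only the part `T ε = γ / (4 C)` is multiplied by the discrimination.

Altogether the gap of `M` under `Mbar` is at most `3 · 2R + (γ/2) H + 2R + (γ/2) H + 2T/γ`. The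
penalty `γ H` cancels both Hellinger terms, and `2T/γ ≤ √T`. -/

/-! ### From the tail bound to the mean. -/

theorem integral_le_of_chebychev_tail {X : Type*} [MeasurableSpace X] (μ : Measure X)
    [IsProbabilityMeasure μ] {Y : X → ℝ} (hY : Integrable Y μ) {R : ℝ} (hR : 0 < R)
    (h : ∀ x : ℝ, 0 < x → μ.real {ω | x ≤ Y ω} ≤ R ^ 2 / x ^ 2) : ∫ ω, Y ω ∂μ ≤ 2 * R := by
  have hpos : Integrable (fun ω => max (Y ω) 0) μ := hY.pos_part
  have h1 : ∫ ω, Y ω ∂μ ≤ ∫ ω, max (Y ω) 0 ∂μ :=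
    integral_mono hY hpos fun ω => le_max_left _ _
  refine h1.trans ?_
  rw [hpos.integral_eq_integral_meas_le (Filter.Eventually.of_forall fun ω => le_max_right _ _)]
  have e : Set.Ioi (0 : ℝ) = Set.Ioc 0 R ∪ Set.Ioi R := (Set.Ioc_union_Ioi_eq_Ioi hR.le).symm
  have hi1 : IntegrableOn (fun _ : ℝ => (1 : ℝ)) (Set.Ioc 0 R) := by
    simp [integrableOn_const_iff]
  have hi2 : IntegrableOn (fun x : ℝ => R ^ 2 * x ^ (-2 : ℝ)) (Set.Ioi R) :=
    (integrableOn_Ioi_rpow_of_lt (by norm_num) hR).const_mul _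
  -- The tail is at most `min 1 (R² / x²)`, whose integral is `R` on each side of the crossover `x =
  -- R`.
  set g : ℝ → ℝ := fun x => if x ≤ R then 1 else R ^ 2 * x ^ (-2 : ℝ) with hg
  have hg1 : Set.EqOn (fun _ : ℝ => (1 : ℝ)) g (Set.Ioc 0 R) := fun x hx => by
    simp [hg, hx.2]
  have hg2 : Set.EqOn (fun x : ℝ => R ^ 2 * x ^ (-2 : ℝ)) g (Set.Ioi R) := fun x hx => by
    simp only [hg]; rw [if_neg (not_le.2 hx)]
  have hG1 : IntegrableOn g (Set.Ioc 0 R) := hi1.congr_fun hg1 measurableSet_Ioc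
  have hG2 : IntegrableOn g (Set.Ioi R) := hi2.congr_fun hg2 measurableSet_Ioi
  have hG : ∫ x in Set.Ioi (0 : ℝ), g x = 2 * R := by
    rw [e, setIntegral_union (Set.Ioc_disjoint_Ioi le_rfl) measurableSet_Ioi hG1 hG2,
      ← setIntegral_congr_fun measurableSet_Ioc hg1, ← setIntegral_congr_fun measurableSet_Ioi hg2,
      integral_const_mul, integral_Ioi_rpow_of_lt (by norm_num) hR]
    have : R ^ ((-2 : ℝ) + 1) = R⁻¹ := by
      rw [show (-2 : ℝ) + 1 = -1 by norm_num, Real.rpow_neg_one]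
    rw [this]
    simp [hR.le]
    field_simp
    norm_num
  rw [← hG]
  refine integral_mono_of_nonneg (Filter.Eventually.of_forall fun _ => measureReal_nonneg)
    (by rw [← IntegrableOn, e]; exact hG1.union hG2) ?_
  filter_upwards [ae_restrict_mem measurableSet_Ioi] with x hx
  have hx : 0 < x := hx
  by_cases hxR : x ≤ R
  · simp only [hg]; rw [if_pos hxR]; exact measureReal_le_one
  · simp only [hg]; rw [if_neg hxR, Real.rpow_neg hx.le, ← div_eq_mul_inv, Real.rpow_two]
    refine le_trans (le_of_eq ?_) (h x hx)
    congr 1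
    ext ω
    simp only [Set.mem_ofPred_eq, le_max_iff]
    constructor
    · rintro (h | h)
      · exact h
      · linarith
    · exact Or.inl

namespace DMSO

variable {D : Type u} {O : Type v} [MeasurableSpace D] [MeasurableSpace O]

-- The law of the history.

attribute [instance] Algorithm.isMarkov

instance Adversary.isMarkovKernel_kernel (adv : Adversary D O) (t : ℕ) :
    IsMarkovKernel (adv.kernel t) :=
  ⟨fun x => inferInstanceAs (IsProbabilityMeasure (adv.model t x.1 x.2 : Measure (Outcome O)))⟩

theorem measurable_snoc (t : ℕ) :
    Measurable fun x : History D O t × (D × Outcome O) =>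
      (Fin.snoc (α := fun _ => D × Outcome O) x.1 x.2 : History D O (t + 1)) := by
  refine measurable_pi_iff.2 fun i => ?_
  refine Fin.lastCases ?_ (fun j => ?_) i
  · simpa using measurable_snd
  · simp only [Fin.snoc_castSucc]
    exact (measurable_pi_apply j).comp measurable_fst

instance isProbabilityMeasure_law (alg : Algorithm D O) (adv : Adversary D O) :
    ∀ t, IsProbabilityMeasure (law alg adv t)
  | 0 => by unfold law; infer_instance
  | t + 1 => by
    have := isProbabilityMeasure_law alg adv t
    unfold law
    exact Measure.isProbabilityMeasure_map (measurable_snoc t).aemeasurable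

theorem lintegral_law_succ (alg : Algorithm D O) (adv : Adversary D O) (t : ℕ)
    {f : History D O (t + 1) → ℝ≥0∞} (hf : Measurable f) :
    ∫⁻ h, f h ∂law alg adv (t + 1) =
      ∫⁻ h, ∫⁻ π, ∫⁻ z, f (Fin.snoc (α := fun _ => D × Outcome O) h (π, z))
        ∂(adv.kernel t (h, π)) ∂(alg.policy t h) ∂law alg adv t := by
  have hF := hf.comp (measurable_snoc (D := D) (O := O) t)
  rw [law, lintegral_map hf (measurable_snoc t)]
  refine (Measure.lintegral_compProd hF).trans ?_
  refine lintegral_congr fun h => ?_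
  exact Kernel.lintegral_compProd _ _ _ (hF.comp measurable_prodMk_left)

theorem integral_law_succ (alg : Algorithm D O) (adv : Adversary D O) (t : ℕ)
    {f : History D O (t + 1) → ℝ} (hf : Measurable f) {B : ℝ} (hB : ∀ h, |f h| ≤ B) :
    ∫ h, f h ∂law alg adv (t + 1) =
      ∫ h, ∫ π, ∫ z, f (Fin.snoc (α := fun _ => D × Outcome O) h (π, z))
        ∂(adv.kernel t (h, π)) ∂(alg.policy t h) ∂law alg adv t := by
  have hF := hf.comp (measurable_snoc (D := D) (O := O) t)
  rw [law, integral_map (measurable_snoc t).aemeasurable hf.aestronglyMeasurable]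
  refine (Measure.integral_compProd (.of_bound hF.aestronglyMeasurable B
      (Filter.Eventually.of_forall fun _ => hB _))).trans ?_
  refine integral_congr_ae (Filter.Eventually.of_forall fun h => ?_)
  exact ProbabilityTheory.integral_compProd (.of_bound
      (hF.comp measurable_prodMk_left).aestronglyMeasurable B
      (Filter.Eventually.of_forall fun _ => hB _))

theorem measurable_lintegral_snoc (κ : ∀ t, Kernel (History D O t × D) (Outcome O))
    [∀ t, IsMarkovKernel (κ t)] (t : ℕ) {f : History D O (t + 1) → ℝ≥0∞} (hf : Measurable f) :
    Measurable fun x : History D O t × D =>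
      ∫⁻ z, f (Fin.snoc (α := fun _ => D × Outcome O) x.1 (x.2, z)) ∂(κ t x) := by
  have : Measurable fun y : (History D O t × D) × Outcome O =>
      f (Fin.snoc (α := fun _ => D × Outcome O) y.1.1 (y.1.2, y.2)) :=
    hf.comp ((measurable_snoc t).comp (by fun_prop :
      Measurable fun y : (History D O t × D) × Outcome O => (y.1.1, (y.1.2, y.2))))
  exact this.lintegral_kernel_prod_right'

theorem measurable_past {T : ℕ} (t : Fin T) :
    Measurable fun h : History D O T => past h t :=
  measurable_pi_iff.2 fun _ => measurable_pi_apply _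

theorem law_map_castLE (alg : Algorithm D O) (adv : Adversary D O) (t : ℕ) :
    ∀ (T : ℕ) (h : t ≤ T), (law alg adv T).map (fun x i => x (Fin.castLE h i)) = law alg adv t := by
  intro T h
  induction T, h using Nat.le_induction with
  | base =>
    exact Measure.map_id
  | succ T hT ih =>
    rw [law, Measure.map_map (measurable_pi_iff.2 fun _ => measurable_pi_apply _)
      (measurable_snoc T)]
    have e : ((fun (x : History D O (T + 1)) i => x (Fin.castLE (hT.trans T.le_succ) i)) ∘
        fun x : History D O T × (D × Outcome O) =>
          (Fin.snoc (α := fun _ => D × Outcome O) x.1 x.2 : History D O (T + 1))) =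
        (fun (x : History D O T) i => x (Fin.castLE hT i)) ∘ Prod.fst := by
      funext x i
      exact Fin.snoc_castSucc (α := fun _ => D × Outcome O) x.2 x.1 (Fin.castLE hT i)
    rw [e, ← Measure.map_map (measurable_pi_iff.2 fun _ => measurable_pi_apply _) measurable_fst]
    have := Measure.fst_compProd (law alg adv T) (alg.policy T ⊗ₖ adv.kernel T)
    rw [Measure.fst] at this
    rw [this, ih]

theorem law_map_past (alg : Algorithm D O) (adv : Adversary D O) {T : ℕ} (t : Fin T) :
    (law alg adv T).map (fun h => past h t) = law alg adv t :=
  law_map_castLE alg adv t T t.2.le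

/-! ### Conditional and cumulative means. -/

/-- The conditional mean of a function of the decision in a round, given the previous rounds. -/
def policyMean (alg : Algorithm D O) (t : ℕ) (g : D → ℝ) (h : History D O t) : ℝ :=
  ∫ π, g π ∂alg.policy t h

/-- The expected sum over `T` rounds of a function of the decision and the round. -/
def cumMean (alg : Algorithm D O) (adv : Adversary D O) (T : ℕ) (g : ℕ → D → ℝ) : ℝ :=
  ∑ t : Fin T, ∫ h, policyMean alg t (g t) h ∂law alg adv t

theorem policyMean_const_mul (alg : Algorithm D O) (t : ℕ) (r : ℝ) (g : D → ℝ)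
    (h : History D O t) :
    policyMean alg t (fun π => r * g π) h = r * policyMean alg t g h :=
  integral_const_mul _ _

theorem policyMean_const (alg : Algorithm D O) (t : ℕ) (r : ℝ) (h : History D O t) :
    policyMean alg t (fun _ => r) h = r := by
  simp [policyMean]

theorem policyMean_nonneg (alg : Algorithm D O) (t : ℕ) {g : D → ℝ} (hg : ∀ π, 0 ≤ g π)
    (h : History D O t) : 0 ≤ policyMean alg t g h :=
  integral_nonneg hg

theorem integrable_reward (μ : Measure (Outcome O)) [IsFiniteMeasure μ] :
    Integrable (fun z : Outcome O => (z.1 : ℝ)) μ :=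
  .of_bound (measurable_subtype_coe.comp measurable_fst).aestronglyMeasurable 1
    (Filter.Eventually.of_forall fun z => by
      rw [Real.norm_eq_abs, abs_of_nonneg z.1.2.1]; exact z.1.2.2)

theorem meanReward_mixture {M : Model D O} {n : ℕ} {w : Fin n → ℝ≥0} {N : Fin n → Model D O}
    {π : D} (hM : (M π : Measure (Outcome O)) = ∑ i, w i • (N i π : Measure (Outcome O))) :
    M.meanReward π = ∑ i, (w i : ℝ) * (N i).meanReward π := by
  rw [Model.meanReward, hM, integral_finsetSum_measure fun i _ => integrable_reward _]
  simp only [integral_smul_nnreal_measure]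
  rfl

theorem cumMean_const_mul (alg : Algorithm D O) (adv : Adversary D O) (T : ℕ) (r : ℝ)
    (g : ℕ → D → ℝ) :
    cumMean alg adv T (fun t π => r * g t π) = r * cumMean alg adv T g := by
  simp only [cumMean, policyMean_const_mul, integral_const_mul, Finset.mul_sum]

theorem cumMean_const (alg : Algorithm D O) (adv : Adversary D O) (T : ℕ) (r : ℝ) :
    cumMean alg adv T (fun _ _ => r) = T * r := by
  simp [cumMean, policyMean_const]

theorem cumMean_nonneg (alg : Algorithm D O) (adv : Adversary D O) (T : ℕ) {g : ℕ → D → ℝ}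
    (hg : ∀ t π, 0 ≤ g t π) : 0 ≤ cumMean alg adv T g :=
  Finset.sum_nonneg fun t _ => integral_nonneg fun h => policyMean_nonneg alg t (hg t) h

section Finite

variable [Fintype D] [MeasurableSingletonClass D]

theorem measurable_policyMean (alg : Algorithm D O) (t : ℕ) (g : D → ℝ) :
    Measurable (policyMean alg t g) := by
  have : Measurable fun x : History D O t × D => g x.2 :=
    (measurable_of_countable g).comp measurable_snd
  exact (this.stronglyMeasurable.integral_kernel_prod_right' (κ := alg.policy t)).measurable

theorem exists_abs_policyMean_le (alg : Algorithm D O) (t : ℕ) (g : D → ℝ) :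
    ∃ B, ∀ h, |policyMean alg t g h| ≤ B := by
  refine ⟨∑ π, |g π|, fun h => ?_⟩
  have := norm_integral_le_of_norm_le_const (μ := alg.policy t h) (f := g) (C := ∑ π, |g π|)
    (Filter.Eventually.of_forall fun π =>
      Finset.single_le_sum (f := fun π => |g π|) (fun _ _ => abs_nonneg _) (Finset.mem_univ π))
  simpa [policyMean] using this

theorem integrable_policyMean (alg : Algorithm D O) (t : ℕ) (g : D → ℝ)
    (μ : Measure (History D O t)) [IsFiniteMeasure μ] : Integrable (policyMean alg t g) μ := by
  obtain ⟨B, hB⟩ := exists_abs_policyMean_le alg t g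
  exact .of_bound (measurable_policyMean alg t g).aestronglyMeasurable B
    (Filter.Eventually.of_forall hB)

theorem policyMean_add (alg : Algorithm D O) (t : ℕ) (g g' : D → ℝ) (h : History D O t) :
    policyMean alg t (fun π => g π + g' π) h = policyMean alg t g h + policyMean alg t g' h :=
  integral_add .of_finite .of_finite

theorem policyMean_mono (alg : Algorithm D O) (t : ℕ) {g g' : D → ℝ} (hg : ∀ π, g π ≤ g' π)
    (h : History D O t) : policyMean alg t g h ≤ policyMean alg t g' h :=
  integral_mono .of_finite .of_finite hg

theorem cumMean_add (alg : Algorithm D O) (adv : Adversary D O) (T : ℕ) (g g' : ℕ → D → ℝ) :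
    cumMean alg adv T (fun t π => g t π + g' t π) =
      cumMean alg adv T g + cumMean alg adv T g' := by
  simp only [cumMean, policyMean_add, ← Finset.sum_add_distrib]
  exact Finset.sum_congr rfl fun t _ =>
    integral_add (integrable_policyMean _ _ _ _) (integrable_policyMean _ _ _ _)

theorem integral_sum_policyMean_past (alg : Algorithm D O) (adv : Adversary D O) (T : ℕ)
    (g : ℕ → D → ℝ) :
    ∫ h, ∑ t : Fin T, policyMean alg t (g t) (past h t) ∂law alg adv T =
      cumMean alg adv T g := by
  have hmap := fun t : Fin T => law_map_past alg adv t
  rw [integral_finsetSum, cumMean]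
  · refine Finset.sum_congr rfl fun t _ => ?_
    rw [← hmap t, integral_map (measurable_past t).aemeasurable
      (measurable_policyMean alg t (g t)).aestronglyMeasurable]
  · intro t _
    obtain ⟨B, hB⟩ := exists_abs_policyMean_le alg t (g t)
    exact .of_bound ((measurable_policyMean alg t (g t)).comp
      (measurable_past t)).aestronglyMeasurable B (Filter.Eventually.of_forall fun _ => hB _)

/-- Averaging the marginal laws of the decisions over the rounds gives the distribution to be used
in the infimum of `dec`. -/
theorem exists_cumMean_eq_integral [Nonempty D] (alg : Algorithm D O) (adv : Adversary D O)
    {T : ℕ} (hT : 0 < T) :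
    ∃ p : ProbabilityMeasure D, ∀ g : D → ℝ,
      cumMean alg adv T (fun _ => g) = T * ∫ π, g π ∂(p : Measure D) := by
  let μ : Measure D := ∑ t : Fin T, ((T : ℝ≥0)⁻¹) • (alg.policy t ∘ₘ law alg adv t)
  have hT' : (T : ℝ≥0) ≠ 0 := by exact_mod_cast hT.ne'
  have hμ : IsProbabilityMeasure μ := ⟨by
    simp only [μ, Measure.coe_finsetSum, Finset.sum_apply, Measure.smul_apply, measure_univ,
      Finset.sum_const, Finset.card_univ, Fintype.card_fin]
    rw [ENNReal.smul_def, smul_eq_mul, mul_one, nsmul_eq_mul, ENNReal.coe_inv hT',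
      ENNReal.coe_natCast]
    exact ENNReal.mul_inv_cancel (by exact_mod_cast hT.ne') (by simp)⟩
  refine ⟨⟨μ, hμ⟩, fun g => ?_⟩
  change _ = T * ∫ π, g π ∂μ
  simp only [μ]
  rw [integral_finsetSum_measure fun _ _ => .of_finite, Finset.mul_sum, cumMean]
  refine Finset.sum_congr rfl fun t _ => ?_
  have hc : ∫ π, g π ∂(alg.policy t ∘ₘ law alg adv t) =
      ∫ h, policyMean alg t g h ∂law alg adv t := by
    have := Kernel.integral_comp (κ := Kernel.const Unit (law alg adv t)) (η := alg.policy t)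
      (a := ()) (f := g) .of_finite
    rw [Kernel.comp_apply, Kernel.const_apply] at this
    exact this
  rw [integral_smul_nnreal_measure, hc]
  simp only [NNReal.smul_def, smul_eq_mul, NNReal.coe_inv, NNReal.coe_natCast]
  rw [← mul_assoc, mul_inv_cancel₀ (by exact_mod_cast hT.ne'), one_mul]

/-! ### Oblivious adversaries and mixtures. -/

/-- The adversary that plays a fixed sequence of models. -/
def oblivious (Ms : ℕ → Model D O) : Adversary D O where
  model t _ := Ms t
  measurable t := (measurable_of_countable fun π => (Ms t π : Measure (Outcome O))).comp
    measurable_snd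

theorem oblivious_kernel_apply (Ms : ℕ → Model D O) (t : ℕ) (x : History D O t × D) :
    (oblivious Ms).kernel t x = (Ms t x.2 : Measure (Outcome O)) := rfl

theorem law_oblivious_congr (alg : Algorithm D O) {Ms Ns : ℕ → Model D O} :
    ∀ t, (∀ s < t, Ms s = Ns s) → law alg (oblivious Ms) t = law alg (oblivious Ns) t
  | 0, _ => rfl
  | t + 1, h => by
    have ih := law_oblivious_congr alg t fun s hs => h s (hs.trans t.lt_succ_self)
    have hk : (oblivious Ms).kernel t = (oblivious Ns).kernel t := by
      ext1 x
      rw [oblivious_kernel_apply, oblivious_kernel_apply, h t t.lt_succ_self]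
    rw [law, law, ih, hk]

/-- The model of round `k` enters the law through one kernel only, so the law is affine in it:
rounds before `k` do not see it, and later rounds propagate the mixture linearly. -/
theorem law_oblivious_mixture (alg : Algorithm D O) (Ms : ℕ → Model D O) (k : ℕ) {n : ℕ}
    (w : Fin n → ℝ≥0) (hw : ∑ i, w i = 1) (N : Fin n → Model D O)
    (hM : ∀ π, (Ms k π : Measure (Outcome O)) = ∑ i, w i • (N i π : Measure (Outcome O))) :
    ∀ t, law alg (oblivious Ms) t =
      ∑ i, w i • law alg (oblivious (Function.update Ms k (N i))) t
  | 0 => by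
    simp only [law]
    rw [← Finset.sum_smul, hw, one_smul]
  | t + 1 => by
    have ih := law_oblivious_mixture alg Ms k w hw N hM t
    refine Measure.ext_of_lintegral _ fun f hf => ?_
    rw [lintegral_finsetSum_measure]
    simp only [lintegral_smul_measure]
    simp only [lintegral_law_succ alg _ t hf, oblivious_kernel_apply]
    have hm : ∀ N : Model D O, Measurable fun x : History D O t × D =>
        ∫⁻ z, f (Fin.snoc (α := fun _ => D × Outcome O) x.1 (x.2, z)) ∂(N x.2 : Measure _) :=
      fun N => measurable_lintegral_snoc (fun t => (oblivious fun _ => N).kernel t) t hf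
    have hm' : ∀ N : Model D O, Measurable fun h : History D O t => ∫⁻ π,
        ∫⁻ z, f (Fin.snoc (α := fun _ => D × Outcome O) h (π, z)) ∂(N π : Measure _)
          ∂alg.policy t h := fun N => (hm N).lintegral_kernel_prod_right'
    by_cases htk : t = k
    · subst htk
      have hl : ∀ i, law alg (oblivious (Function.update Ms t (N i))) t =
          law alg (oblivious Ms) t := fun i =>
        law_oblivious_congr alg t fun s hs => Function.update_of_ne hs.ne _ _
      simp only [hl, Function.update_self, hM, lintegral_finsetSum_measure,
        lintegral_smul_measure, ENNReal.smul_def, smul_eq_mul]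
      have e : ∀ h : History D O t, ∫⁻ π, ∑ i, (w i : ℝ≥0∞) *
            ∫⁻ z, f (Fin.snoc (α := fun _ => D × Outcome O) h (π, z)) ∂(N i π : Measure _)
            ∂alg.policy t h = ∑ i, (w i : ℝ≥0∞) * ∫⁻ π,
            ∫⁻ z, f (Fin.snoc (α := fun _ => D × Outcome O) h (π, z)) ∂(N i π : Measure _)
            ∂alg.policy t h := fun h => by
        rw [lintegral_finsetSum _ fun i _ => measurable_of_countable _]
        exact Finset.sum_congr rfl fun i _ => lintegral_const_mul _ (measurable_of_countable _)
      simp only [e]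
      rw [lintegral_finsetSum _ fun i _ => (hm' (N i)).const_mul _]
      exact Finset.sum_congr rfl fun i _ => lintegral_const_mul _ (hm' (N i))
    · simp only [Function.update_of_ne htk]
      rw [ih, lintegral_finsetSum_measure]
      simp only [lintegral_smul_measure]

/-- The expected regret to a fixed decision against a fixed sequence of models. -/
def meanRegret (alg : Algorithm D O) (Ms : ℕ → Model D O) (T : ℕ) (πstar : D) : ℝ :=
  cumMean alg (oblivious Ms) T fun t π => (Ms t).meanReward πstar - (Ms t).meanReward π

/-- In round `k` the rewards are affine in the model and the past law does not involve it; in every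
other round only the law can depend on it. The comparator is held fixed because a supremum over it
would destroy affinity. -/
theorem meanRegret_mixture (alg : Algorithm D O) (Ms : ℕ → Model D O) (k : ℕ) {n : ℕ}
    (w : Fin n → ℝ≥0) (hw : ∑ i, w i = 1) (N : Fin n → Model D O)
    (hM : ∀ π, (Ms k π : Measure (Outcome O)) = ∑ i, w i • (N i π : Measure (Outcome O)))
    (T : ℕ) (πstar : D) :
    meanRegret alg Ms T πstar =
      ∑ i, (w i : ℝ) * meanRegret alg (Function.update Ms k (N i)) T πstar := by
  simp only [meanRegret, cumMean, Finset.mul_sum]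
  rw [Finset.sum_comm]
  refine Finset.sum_congr rfl fun t _ => ?_
  by_cases htk : (t : ℕ) = k
  · subst htk
    have hl : ∀ i, law alg (oblivious (Function.update Ms t (N i))) t =
        law alg (oblivious Ms) t := fun i =>
      law_oblivious_congr alg t fun s hs => Function.update_of_ne hs.ne _ _
    simp only [hl, Function.update_self, meanReward_mixture (hM _)]
    rw [← Finset.sum_congr rfl fun i _ => integral_const_mul _ _,
      ← integral_finsetSum _ fun i _ => (integrable_policyMean _ _ _ _).const_mul _]
    refine integral_congr_ae (Filter.Eventually.of_forall fun h => ?_)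
    simp only [← policyMean_const_mul]
    simp only [policyMean]
    rw [← integral_finsetSum _ fun i _ => .of_finite]
    simp only [← Finset.sum_sub_distrib, mul_sub]
  · simp only [Function.update_of_ne htk]
    rw [law_oblivious_mixture alg Ms k w hw N hM t,
      integral_finsetSum_measure fun i _ => integrable_policyMean _ _ _ _]
    simp only [integral_smul_nnreal_measure]
    rfl

theorem meanRegret_le_of_isSubChebychev {ℳ : Set (Model D O)} {T : ℕ} {𝒜 : Set (Adversary D O)}
    (h𝒜 : ∀ adv : Adversary D O, adv.IsIn ℳ → adv.IsOblivious → adv ∈ 𝒜)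
    {alg : Algorithm D O} {R : ℝ} (hR : 0 < R) (halg : IsSubChebychev 𝒜 T alg R)
    {Ms : ℕ → Model D O} (hMs : ∀ t, Ms t ∈ ℳ) (πstar : D) :
    meanRegret alg Ms T πstar ≤ 2 * R := by
  have hcheb := halg (oblivious Ms) (h𝒜 _ (fun t _ => hMs t) fun _ _ _ => rfl)
  rw [meanRegret, ← integral_sum_policyMean_past]
  refine integral_le_of_chebychev_tail _ ?_ hR fun x hx => (measureReal_mono ?_).trans (hcheb x hx)
  · refine integrable_finsetSum _ fun t _ => ?_
    obtain ⟨B, hB⟩ := exists_abs_policyMean_le alg t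
      fun π => (Ms t).meanReward πstar - (Ms t).meanReward π
    exact .of_bound ((measurable_policyMean alg t _).comp
      (measurable_past t)).aestronglyMeasurable B (Filter.Eventually.of_forall fun _ => hB _)
  · intro h hh
    refine le_trans (Set.mem_ofPred_eq ▸ hh) (le_trans ?_ (le_max_left _ _))
    exact le_ciSup (f := fun πstar : D => ∑ t : Fin T, policyMean alg t
      (fun π => (Ms t).meanReward πstar - (Ms t).meanReward π) (past h t))
      (Set.finite_range _).bddAbove πstar

/-- Induction on the number `k` of initial rounds that may use mixtures: resolving the last one
writes the regret as an average of regrets bounded by `B`. -/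
theorem meanRegret_convHull_le {ℳ : Set (Model D O)} {alg : Algorithm D O} {T : ℕ} {πstar : D}
    {B : ℝ} (hB : ∀ Ms : ℕ → Model D O, (∀ t, Ms t ∈ ℳ) → meanRegret alg Ms T πstar ≤ B) :
    ∀ (k : ℕ) (Ms : ℕ → Model D O), (∀ t < k, Ms t ∈ convHull ℳ) → (∀ t, k ≤ t → Ms t ∈ ℳ) →
      meanRegret alg Ms T πstar ≤ B
  | 0, Ms, _, h => hB Ms fun t => h t t.zero_le
  | k + 1, Ms, h, h' => by
    obtain ⟨n, w, N, hN, hw, hM⟩ := h k k.lt_succ_self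
    rw [meanRegret_mixture alg Ms k w hw N hM]
    have hw' : ∑ i, (w i : ℝ) = 1 := by exact_mod_cast hw
    calc _ ≤ ∑ i, (w i : ℝ) * B := by
          refine Finset.sum_le_sum fun i _ => mul_le_mul_of_nonneg_left ?_ (w i).2
          refine meanRegret_convHull_le hB k _ (fun t ht => ?_) fun t ht => ?_
          · rw [Function.update_of_ne ht.ne]; exact h t (ht.trans k.lt_succ_self)
          · rcases ht.eq_or_lt with rfl | ht
            · rw [Function.update_self]; exact hN i
            · rw [Function.update_of_ne ht.ne']; exact h' t ht
      _ = B := by rw [← Finset.sum_mul, hw', one_mul]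

/-- The stochastic regret bound: for a fixed model in the convex hull, the expected regret of a
sub-Chebychev algorithm is at most `2 R`. -/
theorem cumMean_gap_le {ℳ : Set (Model D O)} {T : ℕ} {𝒜 : Set (Adversary D O)}
    (h𝒜 : ∀ adv : Adversary D O, adv.IsIn ℳ → adv.IsOblivious → adv ∈ 𝒜)
    {alg : Algorithm D O} {R : ℝ} (hR : 0 < R) (halg : IsSubChebychev 𝒜 T alg R)
    {M : Model D O} (hM : M ∈ convHull ℳ) [Nonempty D] :
    cumMean alg (oblivious fun _ => M) T (fun _ π => M.optReward - M.meanReward π) ≤ 2 * R := by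
  obtain ⟨πstar, hπ⟩ := exists_eq_ciSup_of_finite (f := M.meanReward)
  obtain ⟨N, hN⟩ : ℳ.Nonempty := by
    obtain ⟨n, w, N, hN, hw, -⟩ := hM
    rcases n with _ | n
    · simp at hw
    · exact ⟨_, hN 0⟩
  -- Beyond the horizon the sequence switches to some `N ∈ ℳ`, so that only finitely many rounds use
  -- a mixture; this changes nothing in the first `T` rounds.
  have key := meanRegret_convHull_le (fun Ms hMs =>
    meanRegret_le_of_isSubChebychev h𝒜 hR halg hMs πstar) T
    (fun t => if t < T then M else N) (fun t ht => by simpa [ht] using hM)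
    (fun t ht => by simpa [not_lt.2 ht] using hN)
  refine le_trans (le_of_eq ?_) key
  rw [meanRegret, cumMean, cumMean, Model.optReward, ← hπ]
  refine Finset.sum_congr rfl fun t _ => ?_
  rw [law_oblivious_congr alg t (Ms := fun _ => M) (Ns := fun t => if t < T then M else N)
    fun s hs => by simp [hs.trans t.2]]
  simp [t.2]

end Finite

end DMSO

/-! ### Densities with respect to the midpoint of two measures. -/

theorem exists_density_half_add {X : Type*} [MeasurableSpace X] (P Q : Measure X)
    [IsProbabilityMeasure P] [IsProbabilityMeasure Q] :
    ∃ a : X → ℝ, Measurable a ∧ (∀ x, 0 ≤ a x) ∧ (∀ x, a x ≤ 2) ∧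
      P = ((2⁻¹ : ℝ≥0∞) • (P + Q)).withDensity (fun x => ENNReal.ofReal (a x)) ∧
      ∀ᵐ x ∂(P + Q), a x = 2 * (P.rnDeriv (P + Q) x).toReal := by
  have hle : P ≤ P + Q := Measure.le_add_right le_rfl
  have hae : ∀ᵐ x ∂(P + Q), min (2 * (P.rnDeriv (P + Q) x).toReal) 2 =
      2 * (P.rnDeriv (P + Q) x).toReal := by
    filter_upwards [Measure.rnDeriv_le_one_of_le hle] with x hx
    have : (P.rnDeriv (P + Q) x).toReal ≤ 1 := by
      have := ENNReal.toReal_mono ENNReal.one_ne_top hx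
      simpa using this
    exact min_eq_left (by linarith)
  -- Truncation at `2` changes the density on a null set only and makes the bound hold everywhere,
  -- so products along histories are bounded pointwise.
  refine ⟨fun x => min (2 * (P.rnDeriv (P + Q) x).toReal) 2, by fun_prop,
    fun x => by positivity, fun x => min_le_right _ _, ?_, hae⟩
  rw [withDensity_smul_measure]
  have : (fun x => ENNReal.ofReal (min (2 * (P.rnDeriv (P + Q) x).toReal) 2)) =ᵐ[P + Q]
      (2 : ℝ≥0∞) • P.rnDeriv (P + Q) := by
    filter_upwards [hae, Measure.rnDeriv_lt_top P (P + Q)] with x hx hx'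
    rw [hx, ENNReal.ofReal_mul (by norm_num), ENNReal.ofReal_toReal hx'.ne]
    simp
  rw [withDensity_congr_ae this, withDensity_smul _ (Measure.measurable_rnDeriv _ _),
    Measure.withDensity_rnDeriv_eq _ _ hle.absolutelyContinuous, smul_smul,
    ENNReal.inv_mul_cancel (by norm_num) (by norm_num), one_smul]

theorem exists_densities_half_add {X : Type*} [MeasurableSpace X] (P Q : Measure X)
    [IsProbabilityMeasure P] [IsProbabilityMeasure Q] :
    ∃ a b : X → ℝ, Measurable a ∧ Measurable b ∧ (∀ x, 0 ≤ a x) ∧ (∀ x, 0 ≤ b x) ∧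
      (∀ x, a x ≤ 2) ∧ (∀ x, b x ≤ 2) ∧
      P = ((2⁻¹ : ℝ≥0∞) • (P + Q)).withDensity (fun x => ENNReal.ofReal (a x)) ∧
      Q = ((2⁻¹ : ℝ≥0∞) • (P + Q)).withDensity (fun x => ENNReal.ofReal (b x)) ∧
      DMSO.sqHellinger P Q = ∫ x, (√(a x) - √(b x)) ^ 2 ∂((2⁻¹ : ℝ≥0∞) • (P + Q)) := by
  obtain ⟨a, ha, ha0, ha2, hP, hae⟩ := exists_density_half_add P Q
  obtain ⟨b, hb, hb0, hb2, hQ, hbe⟩ := exists_density_half_add Q P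
  rw [add_comm Q P] at hQ hbe
  refine ⟨a, b, ha, hb, ha0, hb0, ha2, hb2, hP, hQ, ?_⟩
  rw [integral_smul_measure, DMSO.sqHellinger, ← integral_smul]
  refine integral_congr_ae ?_
  filter_upwards [hae, hbe] with x hx hx'
  rw [hx, hx', Real.sqrt_mul (by norm_num), Real.sqrt_mul (by norm_num), ← mul_sub, mul_pow]
  simp

/-! ### Scalar inequalities for the triangular affinity. -/

/-- Half the harmonic mean, the integrand of the triangular affinity. -/
def halfHarmonic (u v : ℝ) : ℝ := u * v / (u + v)

theorem halfHarmonic_nonneg {u v : ℝ} (hu : 0 ≤ u) (hv : 0 ≤ v) : 0 ≤ halfHarmonic u v := by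
  unfold halfHarmonic; positivity

theorem halfHarmonic_le_left {u v : ℝ} (hu : 0 ≤ u) (hv : 0 ≤ v) : halfHarmonic u v ≤ u := by
  unfold halfHarmonic
  refine div_le_of_le_mul₀ (by positivity) hu ?_
  nlinarith [sq_nonneg u]

theorem measurable_halfHarmonic : Measurable fun x : ℝ × ℝ => halfHarmonic x.1 x.2 := by
  unfold halfHarmonic; fun_prop

/-- First-order expansion of `halfHarmonic` about `(u α², v α²)` with exact remainder. Factoring `β²
- α²` in the remainder exposes `(α - β)²`. Expanding at `α` rather than symmetrically leaves the
prefactor `u`, so the Hellinger cost is weighted by one law alone. -/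
theorem halfHarmonic_step_aux {u v α β : ℝ} (hu : 0 < u) (hv : 0 < v)
    (h : 0 < u * α ^ 2 + v * β ^ 2) :
    α ^ 2 * halfHarmonic u v + u ^ 2 * v / (u + v) ^ 2 * (β ^ 2 - α ^ 2)
      - 2 * u * (α - β) ^ 2 ≤ halfHarmonic (u * α ^ 2) (v * β ^ 2) := by
  have key : halfHarmonic (u * α ^ 2) (v * β ^ 2) =
      α ^ 2 * halfHarmonic u v + u ^ 2 * v / (u + v) ^ 2 * (β ^ 2 - α ^ 2)
        - u ^ 2 * v ^ 2 * (β ^ 2 - α ^ 2) ^ 2 / ((u + v) ^ 2 * (u * α ^ 2 + v * β ^ 2)) := by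
    unfold halfHarmonic
    have h1 := h.ne'
    have h2 := (add_pos hu hv).ne'
    field_simp
    ring
  rw [key]
  have : u ^ 2 * v ^ 2 * (β ^ 2 - α ^ 2) ^ 2 / ((u + v) ^ 2 * (u * α ^ 2 + v * β ^ 2)) ≤
      2 * u * (α - β) ^ 2 := by
    rw [div_le_iff₀ (by positivity)]
    have e : u * v ^ 2 * (α + β) ^ 2 ≤ 2 * ((u + v) ^ 2 * (u * α ^ 2 + v * β ^ 2)) := by
      have h1 : (α + β) ^ 2 ≤ 2 * (α ^ 2 + β ^ 2) := by nlinarith [sq_nonneg (α - β)]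
      have h2 : v ^ 2 ≤ (u + v) ^ 2 := by nlinarith
      have h3 : u * v ≤ (u + v) ^ 2 := by nlinarith
      have h4 := mul_le_mul_of_nonneg_left h1 (by positivity : 0 ≤ u * v ^ 2)
      have h5 := mul_le_mul_of_nonneg_right h2 (by positivity : 0 ≤ u * α ^ 2)
      have h6 := mul_le_mul_of_nonneg_right h3 (by positivity : 0 ≤ v * β ^ 2)
      nlinarith
    have := mul_le_mul_of_nonneg_left e (by positivity : 0 ≤ u * (α - β) ^ 2)
    nlinarith
  linarith

theorem halfHarmonic_step {u v a b : ℝ} (hu : 0 ≤ u) (hv : 0 ≤ v) (ha : 0 ≤ a) (hb : 0 ≤ b) :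
    a * halfHarmonic u v + u ^ 2 * v / (u + v) ^ 2 * (b - a) - 2 * u * (√a - √b) ^ 2 ≤
      halfHarmonic (u * a) (v * b) := by
  rcases hu.eq_or_lt with rfl | hu
  · simp [halfHarmonic]
  rcases hv.eq_or_lt with rfl | hv
  · simp only [halfHarmonic]; simp; positivity
  obtain ⟨α, hα, rfl⟩ : ∃ α, 0 ≤ α ∧ α ^ 2 = a := ⟨√a, Real.sqrt_nonneg _, Real.sq_sqrt ha⟩
  obtain ⟨β, hβ, rfl⟩ : ∃ β, 0 ≤ β ∧ β ^ 2 = b := ⟨√b, Real.sqrt_nonneg _, Real.sq_sqrt hb⟩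
  rw [Real.sqrt_sq hα, Real.sqrt_sq hβ]
  by_cases h : 0 < u * α ^ 2 + v * β ^ 2
  · exact halfHarmonic_step_aux hu hv h
  · have h1 : u * α ^ 2 = 0 := le_antisymm (by nlinarith [mul_nonneg hv.le hb]) (by positivity)
    have h2 : v * β ^ 2 = 0 := le_antisymm (by nlinarith [mul_nonneg hu.le ha]) (by positivity)
    have h1 : α = 0 := by simpa [hu.ne'] using h1
    have h2 : β = 0 := by simpa [hv.ne'] using h2
    simp [h1, h2, halfHarmonic]

/-- The pointwise change of measure: `u + v - 4 * halfHarmonic u v` equals `(u - v)² / (u + v)`,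
which is at least `u / 3` once `u > 3 v`. The part `W` of `X` stays under `u` and needs no bound. -/
theorem mul_le_three_mul_add {u v X B W : ℝ} (hu : 0 ≤ u) (hv : 0 ≤ v) (hX : 0 ≤ X) (hB : 0 ≤ B)
    (hW : 0 ≤ W) (hXB : X ≤ B + W) :
    u * X ≤ 3 * (v * X) + 3 * B * (u + v - 4 * halfHarmonic u v) + u * W := by
  rcases (add_nonneg hu hv).eq_or_lt with h0 | h0
  · have h1 : u = 0 := by linarith
    have h2 : v = 0 := by linarith
    simp [h1, h2, halfHarmonic]
  have e : u + v - 4 * halfHarmonic u v = (u - v) ^ 2 / (u + v) := by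
    unfold halfHarmonic; field_simp; ring
  rw [e]
  have hq : 0 ≤ (u - v) ^ 2 / (u + v) := by positivity
  by_cases h : u ≤ 3 * v
  · have := mul_le_mul_of_nonneg_right h hX
    have := mul_nonneg hB hq
    have := mul_nonneg hu hW
    nlinarith
  · have hu3 : u ≤ 3 * ((u - v) ^ 2 / (u + v)) := by
      rw [← mul_div_assoc, le_div_iff₀ h0]
      nlinarith
    have := mul_le_mul_of_nonneg_left hu3 hB
    have := mul_le_mul_of_nonneg_left hXB hu
    have := mul_nonneg hv hX
    nlinarith

/-! ### One-round estimates for pairs of models. -/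

namespace DMSO

variable {D : Type u} {O : Type v} [MeasurableSpace O]

/-- The equal mixture of two models. -/
def halfMixture (M M' : Model D O) : Model D O := fun π =>
  ⟨(2⁻¹ : ℝ≥0∞) • ((M π : Measure (Outcome O)) + (M' π : Measure (Outcome O))), ⟨by
    simp only [Measure.smul_apply, Measure.add_apply, measure_univ, smul_eq_mul]
    rw [one_add_one_eq_two]
    exact ENNReal.inv_mul_cancel (by norm_num) (by norm_num)⟩⟩

/-- `a` is a family of densities of `M` with respect to `N`, with values in `[0, 2]`. -/
structure IsDensity (M N : Model D O) (a : D → Outcome O → ℝ) : Prop where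
  measurable : ∀ π, Measurable (a π)
  nonneg : ∀ π z, 0 ≤ a π z
  le_two : ∀ π z, a π z ≤ 2
  eq_withDensity : ∀ π, (M π : Measure (Outcome O)) =
    (N π : Measure (Outcome O)).withDensity fun z => ENNReal.ofReal (a π z)

theorem exists_isDensity (M M' : Model D O) :
    ∃ a b : D → Outcome O → ℝ, IsDensity M (halfMixture M M') a ∧
      IsDensity M' (halfMixture M M') b ∧ ∀ π,
      sqHellinger (M π : Measure (Outcome O)) (M' π : Measure (Outcome O)) =
        ∫ z, (√(a π z) - √(b π z)) ^ 2 ∂(halfMixture M M' π : Measure (Outcome O)) := by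
  choose a b h1 h2 h3 h4 h5 h6 h7 h8 h9 using fun π =>
    exists_densities_half_add (M π : Measure (Outcome O)) (M' π : Measure (Outcome O))
  exact ⟨a, b, ⟨h1, h3, h5, h7⟩, ⟨h2, h4, h6, h8⟩, h9⟩

namespace IsDensity

variable {M N : Model D O} {a : D → Outcome O → ℝ}

theorem integral_eq (ha : IsDensity M N a) (π : D) (f : Outcome O → ℝ) :
    ∫ z, f z ∂(M π : Measure (Outcome O)) =
      ∫ z, a π z * f z ∂(N π : Measure (Outcome O)) := by
  rw [ha.eq_withDensity, integral_withDensity_eq_integral_toReal_smul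
    (ha.measurable π).ennreal_ofReal (Filter.Eventually.of_forall fun _ => ENNReal.ofReal_lt_top)]
  simp only [ENNReal.toReal_ofReal (ha.nonneg π _), smul_eq_mul]

theorem integrable (ha : IsDensity M N a) (π : D) : Integrable (a π) (N π : Measure (Outcome O)) :=
  .of_bound (ha.measurable π).aestronglyMeasurable 2 (Filter.Eventually.of_forall fun z => by
    rw [Real.norm_eq_abs, abs_of_nonneg (ha.nonneg π z)]; exact ha.le_two π z)

theorem integral_eq_one (ha : IsDensity M N a) (π : D) : ∫ z, a π z ∂(N π : Measure (Outcome O)) = 1 := by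
  have := ha.integral_eq π fun _ => 1
  simpa using this.symm

end IsDensity

theorem sqHellinger_nonneg {X : Type*} [MeasurableSpace X] (P Q : Measure X) :
    0 ≤ sqHellinger P Q := integral_nonneg fun _ => sq_nonneg _

/-- The linear term of `halfHarmonic_step` integrates to zero because both densities have mass one.
-/
theorem halfHarmonic_integral_step {M M' N : Model D O} {a b : D → Outcome O → ℝ}
    (ha : IsDensity M N a) (hb : IsDensity M' N b) {u v : ℝ}
    (hu : 0 ≤ u) (hv : 0 ≤ v) (π : D) :
    halfHarmonic u v - 2 * u * ∫ z, (√(a π z) - √(b π z)) ^ 2 ∂(N π : Measure (Outcome O)) ≤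
      ∫ z, halfHarmonic (u * a π z) (v * b π z) ∂(N π : Measure (Outcome O)) := by
  have hia := ha.integrable π
  have hib := hb.integrable π
  have hma := ha.measurable π
  have hmb := hb.measurable π
  have hsq : Integrable (fun z => (√(a π z) - √(b π z)) ^ 2) (N π : Measure (Outcome O)) := by
    refine (hia.add hib).mono' (by fun_prop) (Filter.Eventually.of_forall fun z => ?_)
    rw [Real.norm_eq_abs, abs_of_nonneg (sq_nonneg _), Pi.add_apply]
    nlinarith [Real.sq_sqrt (ha.nonneg π z), Real.sq_sqrt (hb.nonneg π z),
      mul_nonneg (Real.sqrt_nonneg (a π z)) (Real.sqrt_nonneg (b π z))]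
  have hψ : Integrable (fun z => halfHarmonic (u * a π z) (v * b π z))
      (N π : Measure (Outcome O)) := by
    refine (hia.const_mul u).mono' (measurable_halfHarmonic.comp
      (by fun_prop : Measurable fun z => (u * a π z, v * b π z))).aestronglyMeasurable
      (Filter.Eventually.of_forall fun z => ?_)
    have h1 := mul_nonneg hu (ha.nonneg π z)
    have h2 := mul_nonneg hv (hb.nonneg π z)
    rw [Real.norm_eq_abs, abs_of_nonneg (halfHarmonic_nonneg h1 h2)]
    exact halfHarmonic_le_left h1 h2
  have key := integral_mono (((hia.mul_const (halfHarmonic u v)).add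
    ((hib.sub hia).const_mul (u ^ 2 * v / (u + v) ^ 2))).sub (hsq.const_mul (2 * u))) hψ
    fun z => halfHarmonic_step hu hv (ha.nonneg π z) (hb.nonneg π z)
  refine le_trans (le_of_eq ?_) key
  rw [integral_sub' ((hia.mul_const _).add ((hib.sub hia).const_mul _)) (hsq.const_mul _),
    integral_add' (hia.mul_const _) ((hib.sub hia).const_mul _), integral_mul_const,
    integral_const_mul, integral_const_mul, integral_sub' hib hia, ha.integral_eq_one, hb.integral_eq_one]
  ring

/-- Write `b - a = (√b - √a)(√b + √a)` and apply AM-GM with weight `γ`; the integral of `(√a + √b)²`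
is at most `4`. -/
theorem meanReward_sub_le (M M' : Model D O) {γ : ℝ} (hγ : 0 < γ) (π : D) :
    M'.meanReward π - M.meanReward π ≤
      γ / 2 * sqHellinger (M π : Measure (Outcome O)) (M' π : Measure (Outcome O)) + 2 / γ := by
  obtain ⟨a, b, ha, hb, hd⟩ := exists_isDensity M M'
  set ν := (halfMixture M M' π : Measure (Outcome O))
  have hia : Integrable (a π) ν := ha.integrable π
  have hib : Integrable (b π) ν := hb.integrable π
  have hma := ha.measurable π
  have hmb := hb.measurable π
  have hsq : Integrable (fun z => (√(a π z) - √(b π z)) ^ 2) ν := by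
    refine (hia.add hib).mono' (by fun_prop) (Filter.Eventually.of_forall fun z => ?_)
    rw [Real.norm_eq_abs, abs_of_nonneg (sq_nonneg _), Pi.add_apply]
    nlinarith [Real.sq_sqrt (ha.nonneg π z), Real.sq_sqrt (hb.nonneg π z),
      mul_nonneg (Real.sqrt_nonneg (a π z)) (Real.sqrt_nonneg (b π z))]
  have hr : ∀ z : Outcome O, ‖(z.1 : ℝ)‖ ≤ 1 := fun z => by
    rw [Real.norm_eq_abs, abs_of_nonneg z.1.2.1]; exact z.1.2.2
  have hra : Integrable (fun z : Outcome O => a π z * (z.1 : ℝ)) ν :=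
    hia.mul_bdd (by fun_prop) (Filter.Eventually.of_forall hr)
  have hrb : Integrable (fun z : Outcome O => b π z * (z.1 : ℝ)) ν :=
    hib.mul_bdd (by fun_prop) (Filter.Eventually.of_forall hr)
  rw [hd, Model.meanReward, Model.meanReward, hb.integral_eq, ha.integral_eq,
    ← integral_sub hrb hra]
  have key := integral_mono (hrb.sub hra) ((hsq.const_mul (γ / 2)).add
    ((hia.add hib).const_mul (1 / γ))) fun z => ?_
  · refine key.trans (le_of_eq ?_)
    rw [integral_add' (hsq.const_mul _) ((hia.add hib).const_mul _), integral_const_mul,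
      integral_const_mul, integral_add' hia hib, ha.integral_eq_one, hb.integral_eq_one]
    ring
  · simp only [Pi.add_apply, Pi.sub_apply]
    have h0 : (0 : ℝ) ≤ z.1 := z.1.2.1
    have h1 : (z.1 : ℝ) ≤ 1 := z.1.2.2
    have ea := Real.sq_sqrt (ha.nonneg π z)
    have eb := Real.sq_sqrt (hb.nonneg π z)
    set α := √(a π z)
    set β := √(b π z)
    rw [← ea, ← eb]
    have e1 : β ^ 2 * z.1 - α ^ 2 * z.1 ≤ |β ^ 2 - α ^ 2| := by
      rw [← sub_mul]
      calc _ ≤ |β ^ 2 - α ^ 2| * z.1 := mul_le_mul_of_nonneg_right (le_abs_self _) h0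
        _ ≤ _ := mul_le_of_le_one_right (abs_nonneg _) h1
    refine e1.trans ?_
    have e2 : (γ * (α - β)) ^ 2 + (α + β) ^ 2 ≤ (γ * (α - β)) ^ 2 + 2 * (α ^ 2 + β ^ 2) := by
      nlinarith [sq_nonneg (α - β)]
    have e3 : 2 * γ * |β ^ 2 - α ^ 2| ≤ (γ * (α - β)) ^ 2 + 2 * (α ^ 2 + β ^ 2) := by
      refine le_trans ?_ e2
      rcases abs_cases (β ^ 2 - α ^ 2) with ⟨h, -⟩ | ⟨h, -⟩ <;> rw [h]
      · nlinarith [sq_nonneg (γ * (α - β) + (α + β))]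
      · nlinarith [sq_nonneg (γ * (α - β) - (α + β))]
    have e4 : γ / 2 * (α - β) ^ 2 + 1 / γ * (α ^ 2 + β ^ 2) =
        ((γ * (α - β)) ^ 2 + 2 * (α ^ 2 + β ^ 2)) / (2 * γ) := by
      field_simp
    rw [e4, le_div_iff₀ (by positivity)]
    linarith

/-- Both entries of the minimum are at least `2`, and `20 log 2 > 12`. The minimum is finite because
`T` is, so `toReal` is faithful. -/
theorem logFactor_ge {c : ℝ} (hc : 20 ≤ c) (ℳ : Set (Model D O)) {T : ℕ} (hT : 2 ≤ T) :
    12 ≤ logFactor c ℳ T := by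
  have hexp : (2 : ℝ) ≤ Real.exp 1 := by linarith [Real.add_one_le_exp (1 : ℝ)]
  have h2 : (2 : ℝ≥0∞) ≤ min (T : ℝ≥0∞) (densityRatio ℳ) := by
    refine le_min (by exact_mod_cast hT) (le_trans ?_ le_sup_right)
    rw [← ENNReal.ofReal_ofNat]
    exact ENNReal.ofReal_le_ofReal hexp
  have h3 : (2 : ℝ) ≤ (min (T : ℝ≥0∞) (densityRatio ℳ)).toReal := by
    have := ENNReal.toReal_mono
      (ne_top_of_le_ne_top (ENNReal.natCast_ne_top T) (min_le_left _ _)) h2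
    simpa using this
  have h4 := Real.log_le_log (by norm_num) h3
  have h5 := Real.log_two_gt_d9
  unfold logFactor
  nlinarith

/-! ### Likelihood ratios and change of measure on histories. -/

/-- The product of the step densities along a history. -/
def weight (a : D → Outcome O → ℝ) (t : ℕ) (h : History D O t) : ℝ :=
  ∏ i, a (h i).1 (h i).2

theorem weight_snoc (a : D → Outcome O → ℝ) (t : ℕ) (h : History D O t) (x : D × Outcome O) :
    weight a (t + 1) (Fin.snoc (α := fun _ => D × Outcome O) h x) = weight a t h * a x.1 x.2 := by
  simp [weight, Fin.prod_univ_castSucc]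

namespace IsDensity

variable {M N : Model D O} {a : D → Outcome O → ℝ}

theorem weight_nonneg (ha : IsDensity M N a) {t : ℕ} (h : History D O t) : 0 ≤ weight a t h :=
  Finset.prod_nonneg fun _ _ => ha.nonneg _ _

theorem weight_le (ha : IsDensity M N a) {t : ℕ} (h : History D O t) : weight a t h ≤ 2 ^ t := by
  have := Finset.prod_le_prod (s := Finset.univ) (f := fun i : Fin t => a (h i).1 (h i).2)
    (g := fun _ => 2) (fun _ _ => ha.nonneg _ _) (fun _ _ => ha.le_two _ _)
  simpa [weight] using this

end IsDensity

variable [MeasurableSpace D] [Fintype D] [MeasurableSingletonClass D]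

namespace IsDensity

variable {M N : Model D O} {a : D → Outcome O → ℝ}

theorem measurable_weight (ha : IsDensity M N a) (t : ℕ) : Measurable (weight a t) := by
  have : Measurable fun x : D × Outcome O => a x.1 x.2 :=
    measurable_from_prod_countable_right ha.measurable
  exact Finset.measurable_fun_prod _ fun i _ => this.comp (measurable_pi_apply i)

/-- The policies are the same under both models and cancel, leaving the product of the outcome
densities. -/
theorem law_eq_withDensity (ha : IsDensity M N a) (alg : Algorithm D O) :
    ∀ t, law alg (oblivious fun _ => M) t =
      (law alg (oblivious fun _ => N) t).withDensity fun h => ENNReal.ofReal (weight a t h)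
  | 0 => by simp [law, weight]
  | t + 1 => by
    have ih := ha.law_eq_withDensity alg t
    have hw := fun t => (ha.measurable_weight t).ennreal_ofReal
    refine Measure.ext_of_lintegral _ fun f hf => ?_
    have hm : Measurable fun x : History D O t × D =>
        ∫⁻ z, f (Fin.snoc (α := fun _ => D × Outcome O) x.1 (x.2, z)) ∂(M x.2 : Measure _) :=
      measurable_lintegral_snoc (fun t => (oblivious fun _ => M).kernel t) t hf
    rw [lintegral_withDensity_eq_lintegral_mul _ (hw _) hf, lintegral_law_succ alg _ t hf,
      lintegral_law_succ alg _ t ((hw _).mul hf), ih]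
    refine (lintegral_withDensity_eq_lintegral_mul _ (hw t)
        (hm.lintegral_kernel_prod_right' (κ := alg.policy t))).trans ?_
    refine lintegral_congr fun h => ?_
    simp only [Pi.mul_apply]
    rw [← lintegral_const_mul _ (measurable_of_countable _)]
    refine lintegral_congr fun π => ?_
    have hfz : Measurable fun z => f (Fin.snoc (α := fun _ => D × Outcome O) h (π, z)) :=
      hf.comp ((measurable_snoc t).comp (by fun_prop :
        Measurable fun z : Outcome O => (h, (π, z))))
    simp only [oblivious_kernel_apply]
    rw [ha.eq_withDensity, lintegral_withDensity_eq_lintegral_mul _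
      (ha.measurable π).ennreal_ofReal hfz, ← lintegral_const_mul _
      ((ha.measurable π).ennreal_ofReal.mul hfz)]
    refine lintegral_congr fun z => ?_
    rw [weight_snoc, ENNReal.ofReal_mul (ha.weight_nonneg h), Pi.mul_apply, mul_assoc]

theorem integral_law_eq (ha : IsDensity M N a) (alg : Algorithm D O) (t : ℕ)
    (f : History D O t → ℝ) :
    ∫ h, f h ∂law alg (oblivious fun _ => M) t =
      ∫ h, weight a t h * f h ∂law alg (oblivious fun _ => N) t := by
  rw [ha.law_eq_withDensity, integral_withDensity_eq_integral_toReal_smul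
    (ha.measurable_weight t).ennreal_ofReal
    (Filter.Eventually.of_forall fun _ => ENNReal.ofReal_lt_top)]
  simp only [ENNReal.toReal_ofReal (ha.weight_nonneg _), smul_eq_mul]

theorem integrable_weight_mul (ha : IsDensity M N a) {t : ℕ} (μ : Measure (History D O t))
    [IsFiniteMeasure μ] {f : History D O t → ℝ} (hf : Integrable f μ) :
    Integrable (fun h => weight a t h * f h) μ :=
  hf.bdd_mul (ha.measurable_weight t).aestronglyMeasurable (Filter.Eventually.of_forall fun h => by
    rw [Real.norm_eq_abs, abs_of_nonneg (ha.weight_nonneg h)]; exact ha.weight_le h)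

theorem integrable_weight (ha : IsDensity M N a) (t : ℕ) (μ : Measure (History D O t))
    [IsFiniteMeasure μ] : Integrable (weight a t) μ := by
  simpa using ha.integrable_weight_mul μ (integrable_const (1 : ℝ))

theorem integral_weight (ha : IsDensity M N a) (alg : Algorithm D O) (t : ℕ) :
    ∫ h, weight a t h ∂law alg (oblivious fun _ => N) t = 1 := by
  have := ha.integral_law_eq alg t fun _ => 1
  simpa using this.symm

end IsDensity

section Affinity

variable {M M' N : Model D O} {a b : D → Outcome O → ℝ}

theorem integrable_halfHarmonic_weight (ha : IsDensity M N a) (hb : IsDensity M' N b) (t : ℕ)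
    (μ : Measure (History D O t)) [IsFiniteMeasure μ] :
    Integrable (fun h => halfHarmonic (weight a t h) (weight b t h)) μ :=
  (ha.integrable_weight t μ).mono' (measurable_halfHarmonic.comp
    ((ha.measurable_weight t).prodMk (hb.measurable_weight t))).aestronglyMeasurable
    (Filter.Eventually.of_forall fun h => by
      rw [Real.norm_eq_abs,
        abs_of_nonneg (halfHarmonic_nonneg (ha.weight_nonneg h) (hb.weight_nonneg h))]
      exact halfHarmonic_le_left (ha.weight_nonneg h) (hb.weight_nonneg h))

/-- Chain rule for the triangular affinity: it decays by at most twice the expected squared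
Hellinger distance in each round. -/
theorem le_integral_halfHarmonic_weight (ha : IsDensity M N a) (hb : IsDensity M' N b)
    {d : D → ℝ} (hd : ∀ π, ∫ z, (√(a π z) - √(b π z)) ^ 2 ∂(N π : Measure (Outcome O)) = d π)
    (alg : Algorithm D O) :
    ∀ T, 2⁻¹ - 2 * cumMean alg (oblivious fun _ => M) T (fun _ => d) ≤
      ∫ h, halfHarmonic (weight a T h) (weight b T h) ∂law alg (oblivious fun _ => N) T
  | 0 => by simp [law, weight, cumMean, halfHarmonic]; norm_num
  | t + 1 => by
    -- The middle term is the affinity after `t` rounds minus the loss of the next one; the weight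
    -- `a` turns that loss into a mean under `M`.
    refine le_trans ?_ (b := ∫ h, (halfHarmonic (weight a t h) (weight b t h) -
      2 * (weight a t h * policyMean alg t d h)) ∂law alg (oblivious fun _ => N) t) ?_
    · have ih := le_integral_halfHarmonic_weight ha hb hd alg t
      rw [integral_sub (integrable_halfHarmonic_weight ha hb t _)
        ((ha.integrable_weight_mul _ (integrable_policyMean alg t d _)).const_mul 2),
        integral_const_mul, ← ha.integral_law_eq alg t]
      simp only [cumMean, Fin.sum_univ_castSucc, Fin.val_castSucc, Fin.val_last] at ih ⊢
      linarith
    have hψ : Measurable fun h : History D O (t + 1) =>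
        halfHarmonic (weight a (t + 1) h) (weight b (t + 1) h) :=
      measurable_halfHarmonic.comp ((ha.measurable_weight _).prodMk (hb.measurable_weight _))
    have hψb : ∀ h : History D O (t + 1),
        |halfHarmonic (weight a (t + 1) h) (weight b (t + 1) h)| ≤ 2 ^ (t + 1) := fun h => by
      rw [abs_of_nonneg (halfHarmonic_nonneg (ha.weight_nonneg h) (hb.weight_nonneg h))]
      exact (halfHarmonic_le_left (ha.weight_nonneg h) (hb.weight_nonneg h)).trans (ha.weight_le h)
    rw [integral_law_succ alg _ t hψ hψb]
    refine integral_mono ((integrable_halfHarmonic_weight ha hb t _).sub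
      ((ha.integrable_weight_mul _ (integrable_policyMean alg t d _)).const_mul 2)) ?_ fun h => ?_
    · have h1 : Measurable fun y : (History D O t × D) × Outcome O =>
          halfHarmonic (weight a (t + 1) (Fin.snoc (α := fun _ => D × Outcome O) y.1.1 (y.1.2, y.2)))
            (weight b (t + 1) (Fin.snoc (α := fun _ => D × Outcome O) y.1.1 (y.1.2, y.2))) :=
        hψ.comp ((measurable_snoc t).comp (by fun_prop :
          Measurable fun y : (History D O t × D) × Outcome O => (y.1.1, (y.1.2, y.2))))
      have h2 := (h1.stronglyMeasurable.integral_kernel_prod_right'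
        (κ := (oblivious fun _ => N).kernel t)).integral_kernel_prod_right' (κ := alg.policy t)
      refine .of_bound h2.aestronglyMeasurable (2 ^ (t + 1)) (Filter.Eventually.of_forall fun h => ?_)
      have h3 : ∀ π, ‖∫ z, halfHarmonic
          (weight a (t + 1) (Fin.snoc (α := fun _ => D × Outcome O) h (π, z)))
          (weight b (t + 1) (Fin.snoc (α := fun _ => D × Outcome O) h (π, z)))
          ∂(oblivious fun _ => N).kernel t (h, π)‖ ≤ 2 ^ (t + 1) := fun π => by
        refine (norm_integral_le_of_norm_le_const (C := 2 ^ (t + 1))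
          (Filter.Eventually.of_forall fun z => ?_)).trans (by simp)
        exact hψb _
      simpa using norm_integral_le_of_norm_le_const (μ := alg.policy t h)
        (Filter.Eventually.of_forall h3)
    · have hu := ha.weight_nonneg h
      have hv := hb.weight_nonneg h
      have h1 : halfHarmonic (weight a t h) (weight b t h) -
          2 * (weight a t h * policyMean alg t d h) =
          ∫ π, (halfHarmonic (weight a t h) (weight b t h) - 2 * weight a t h * d π)
            ∂alg.policy t h := by
        rw [integral_sub .of_finite .of_finite, integral_const_mul, integral_const, policyMean]
        simp [mul_assoc]
      rw [h1]
      refine integral_mono .of_finite .of_finite fun π => ?_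
      simp only [weight_snoc, oblivious_kernel_apply, ← hd]
      exact halfHarmonic_integral_step ha hb hu hv π

/-- The discrimination integrates to at most `2 - 4 (1/2 - 2 H) = 8 H`, and the factor `3 B` of the
pointwise bound gives `24 B H`. -/
theorem integral_law_le_three_mul (ha : IsDensity M N a) (hb : IsDensity M' N b)
    {d : D → ℝ} (hd : ∀ π, ∫ z, (√(a π z) - √(b π z)) ^ 2 ∂(N π : Measure (Outcome O)) = d π)
    (alg : Algorithm D O) (T : ℕ) {X W : History D O T → ℝ} {B : ℝ}
    (hX : ∀ h, 0 ≤ X h) (hW : ∀ h, 0 ≤ W h) (hB : 0 ≤ B) (hXW : ∀ h, X h ≤ B + W h)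
    (hXi : Integrable X (law alg (oblivious fun _ => N) T))
    (hWi : Integrable W (law alg (oblivious fun _ => N) T)) :
    ∫ h, X h ∂law alg (oblivious fun _ => M) T ≤
      3 * ∫ h, X h ∂law alg (oblivious fun _ => M') T +
        24 * B * cumMean alg (oblivious fun _ => M) T (fun _ => d) +
        ∫ h, W h ∂law alg (oblivious fun _ => M) T := by
  set ρ := law alg (oblivious fun _ => N) T
  have hψ := integrable_halfHarmonic_weight ha hb T ρ
  have hu := ha.integrable_weight T ρ
  have hv := hb.integrable_weight T ρ
  have i1 := (hb.integrable_weight_mul ρ hXi).const_mul 3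
  have i2 := ((hu.add hv).sub (hψ.const_mul 4)).const_mul (3 * B)
  have i3 := ha.integrable_weight_mul ρ hWi
  have key := integral_mono (ha.integrable_weight_mul ρ hXi) ((i1.add i2).add i3)
    fun h => mul_le_three_mul_add (ha.weight_nonneg h) (hb.weight_nonneg h) (hX h) hB (hW h) (hXW h)
  rw [integral_add' (i1.add i2) i3, integral_add' i1 i2, integral_const_mul, integral_const_mul,
    integral_sub' (hu.add hv) (hψ.const_mul 4), integral_add' hu hv, integral_const_mul,
    ha.integral_weight, hb.integral_weight, ← ha.integral_law_eq, ← hb.integral_law_eq,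
    ← ha.integral_law_eq] at key
  have := le_integral_halfHarmonic_weight ha hb hd alg T
  nlinarith [mul_le_mul_of_nonneg_left this hB]

end Affinity

theorem cumMean_oblivious_le_three_mul (M M' : Model D O) (alg : Algorithm D O) (T : ℕ)
    {g w : D → ℝ} {ε : ℝ} (hg : ∀ π, 0 ≤ g π) (hw : ∀ π, 0 ≤ w π) (hε : 0 ≤ ε)
    (hgw : ∀ π, g π ≤ ε + w π) :
    cumMean alg (oblivious fun _ => M') T (fun _ => g) ≤
      3 * cumMean alg (oblivious fun _ => M) T (fun _ => g) +
        24 * (T * ε) * cumMean alg (oblivious fun _ => M') T (fun _ π =>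
          sqHellinger (M π : Measure (Outcome O)) (M' π : Measure (Outcome O))) +
        cumMean alg (oblivious fun _ => M') T (fun _ => w) := by
  obtain ⟨a, b, ha, hb, hd⟩ := exists_isDensity M M'
  have hi : ∀ g : D → ℝ, Integrable (fun h => ∑ t : Fin T, policyMean alg t g (past h t))
      (law alg (oblivious fun _ => halfMixture M M') T) := fun g => by
    refine integrable_finsetSum _ fun t _ => ?_
    obtain ⟨B, hB⟩ := exists_abs_policyMean_le alg t g
    exact .of_bound ((measurable_policyMean alg t g).comp
      (measurable_past t)).aestronglyMeasurable B (Filter.Eventually.of_forall fun _ => hB _)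
  -- The roles are swapped so that the Hellinger sum is taken under `M'`, the law on the left, where
  -- the DEC penalty can absorb it.
  have := integral_law_le_three_mul hb ha
    (fun π => (integral_congr_ae (Filter.Eventually.of_forall fun z =>
      sub_sq_comm _ _)).trans (hd π).symm) alg T
    (fun h => Finset.sum_nonneg fun (t : Fin T) _ => policyMean_nonneg alg t hg (past h t))
    (fun h => Finset.sum_nonneg fun (t : Fin T) _ => policyMean_nonneg alg t hw (past h t))
    (mul_nonneg T.cast_nonneg hε) (fun h => ?_) (hi g) (hi w)
  · simpa only [integral_sum_policyMean_past alg _ T fun _ => g,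
      integral_sum_policyMean_past alg _ T fun _ => w] using this
  · calc _ ≤ ∑ t : Fin T, (ε + policyMean alg t w (past h t)) :=
          Finset.sum_le_sum fun t _ => by
            rw [← policyMean_const alg t ε (past h t), ← policyMean_add]
            exact policyMean_mono alg t hgw _
      _ = _ := by simp [Finset.sum_add_distrib]

/-! ### Bounding the decision-estimation coefficient. -/

theorem meanReward_le_optReward (M : Model D O) (π : D) : M.meanReward π ≤ M.optReward :=
  le_ciSup (Set.finite_range _).bddAbove π

/-- The decision-estimation coefficient bounds the regret of an algorithm on two models. -/
theorem cumMean_gap_sub_sqHellinger_le [Nonempty D] (M Mbar : Model D O) (alg : Algorithm D O)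
    {T : ℕ} (hT : 0 < T) {γ C r : ℝ} (hC : 12 ≤ C) (hγ : √(2 * C * T) < γ)
    (hloc : M.optReward - γ / (4 * C * T) ≤ Mbar.optReward)
    (hM : cumMean alg (oblivious fun _ => M) T (fun _ π => M.optReward - M.meanReward π) ≤ r)
    (hMbar : cumMean alg (oblivious fun _ => Mbar) T
      (fun _ π => Mbar.optReward - Mbar.meanReward π) ≤ r) :
    cumMean alg (oblivious fun _ => Mbar) T (fun _ π => M.optReward - M.meanReward π -
      γ * sqHellinger (M π : Measure (Outcome O)) (Mbar π : Measure (Outcome O))) ≤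
      4 * r + √T := by
  have hT' : (0 : ℝ) < T := by exact_mod_cast hT
  have hγ0 : 0 < γ := (Real.sqrt_nonneg _).trans_lt hγ
  set d : D → ℝ := fun π => sqHellinger (M π : Measure (Outcome O)) (Mbar π : Measure (Outcome O))
  have hd0 : ∀ π, 0 ≤ d π := fun π => sqHellinger_nonneg _ _
  set g : D → ℝ := fun π => M.optReward - M.meanReward π with hg
  set gbar : D → ℝ := fun π => Mbar.optReward - Mbar.meanReward π with hgbar
  have hgbar0 : ∀ π, 0 ≤ gbar π := fun π => sub_nonneg.2 (meanReward_le_optReward Mbar π)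
  -- Localization replaces the optimum of `M` by that of `Mbar` at cost `ε`, and `meanReward_sub_le`
  -- compares the rewards of the two models at `π`.
  have key := cumMean_oblivious_le_three_mul M Mbar alg T (g := g)
    (w := fun π => gbar π + (γ / 2 * d π + 2 / γ)) (ε := γ / (4 * C * T))
    (fun π => sub_nonneg.2 (meanReward_le_optReward M π))
    (fun π => by have := hgbar0 π; have := hd0 π; positivity) (by positivity)
    (fun π => by
      have := meanReward_sub_le M Mbar hγ0 π
      simp only [hg, hgbar, d]; linarith)
  rw [cumMean_add (g := fun _ => gbar), cumMean_add (g := fun _ π => γ / 2 * d π), cumMean_const_mul,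
    cumMean_const] at key
  set H := cumMean alg (oblivious fun _ => Mbar) T (fun _ => d)
  have hH : 0 ≤ H := cumMean_nonneg alg _ T fun _ => hd0
  -- The left side is `6 γ / C`, so this is where `C ≥ 12` is needed.
  have e1 : 24 * (T * (γ / (4 * C * T))) ≤ γ / 2 := by
    have : 24 * (T * (γ / (4 * C * T))) = 6 * γ / C := by field_simp; norm_num
    rw [this, div_le_div_iff₀ (by positivity) (by norm_num)]
    nlinarith
  have e2 := mul_le_mul_of_nonneg_right e1 hH
  have e3 : T * (2 / γ) ≤ √T := by
    have hs : 2 * √T ≤ γ := by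
      refine le_trans ?_ hγ.le
      refine Real.le_sqrt_of_sq_le ?_
      rw [mul_pow, Real.sq_sqrt hT'.le]
      nlinarith
    rw [← mul_div_assoc, div_le_iff₀ hγ0]
    nlinarith [Real.mul_self_sqrt hT'.le, mul_le_mul_of_nonneg_left hs (Real.sqrt_nonneg T)]
  have e4 : cumMean alg (oblivious fun _ => Mbar) T (fun _ π => g π - γ * d π) =
      cumMean alg (oblivious fun _ => Mbar) T (fun _ => g) - γ * H := by
    have := cumMean_add alg (oblivious fun _ => Mbar) T (fun _ => g) (fun _ π => (-γ) * d π)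
    rw [cumMean_const_mul] at this
    simp only [neg_mul, ← sub_eq_add_neg] at this
    exact this
  change cumMean alg (oblivious fun _ => Mbar) T (fun _ π => g π - γ * d π) ≤ _
  rw [e4]
  linarith

theorem locDec_convHull_le [Nonempty D] {ℳ : Set (Model D O)} {T : ℕ} (hT : 0 < T)
    {𝒜 : Set (Adversary D O)}
    (h𝒜 : ∀ adv : Adversary D O, adv.IsIn ℳ → adv.IsOblivious → adv ∈ 𝒜)
    {alg : Algorithm D O} {R : ℝ} (hR : 0 < R) (halg : IsSubChebychev 𝒜 T alg R)
    {γ C : ℝ} (hC : 12 ≤ C) (hγ : √(2 * C * T) < γ) :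
    locDec γ (γ / (4 * C * T)) (convHull ℳ) ≤ ((8 * R + √T) / T : ℝ) := by
  refine iSup₂_le fun Mbar hMbar => ?_
  -- `p` depends on `Mbar` only, so it may precede the supremum over `M`.
  obtain ⟨p, hp⟩ := exists_cumMean_eq_integral alg (oblivious fun _ => Mbar) hT
  refine iInf_le_of_le p (iSup₂_le fun M hM => ?_)
  rw [EReal.coe_le_coe_iff, le_div_iff₀' (by exact_mod_cast hT), ← hp]
  have := cumMean_gap_sub_sqHellinger_le M Mbar alg hT hC hγ hM.2
    (cumMean_gap_le h𝒜 hR halg hM.1) (cumMean_gap_le h𝒜 hR halg hMbar)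
  linarith

end DMSO

end

theorem mainTheorem9 :
    ∃ (c₀ a K : ℝ) (k : ℕ), 0 < c₀ ∧ 0 < a ∧ 0 < K ∧
      ∀ (D : Type u) (O : Type v) [Fintype D] [Nonempty D] [MeasurableSpace D]
        [MeasurableSingletonClass D] [MeasurableSpace O]
        (ℳ : Set (DMSO.Model D O)) (c : ℝ) (_ : c₀ ≤ c) (T : ℕ) (_ : 2 ≤ T)
        -- the adversaries may be adaptive; the oblivious ones already suffice
        (𝒜 : Set (DMSO.Adversary D O))
        (_ : ∀ adv : DMSO.Adversary D O, adv.IsIn ℳ → adv.IsOblivious → adv ∈ 𝒜)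
        (alg : DMSO.Algorithm D O) (R : ℝ) (_ : 0 < R)
        (_ : DMSO.IsSubChebychev 𝒜 T alg R),
        ((a / Real.log T ^ k : ℝ) : EReal) *
            (⨆ (γ : ℝ) (_ : √(2 * DMSO.logFactor c ℳ T * T) < γ),
              DMSO.locDec γ (γ / (4 * DMSO.logFactor c ℳ T * T)) (DMSO.convHull ℳ)) *
            ((T : ℝ) : EReal) -
          ((K * √T : ℝ) : EReal) ≤ (R : EReal) := by
  -- Both `1 / 8` come from dividing `8 R + √T` by `8`. The exponent `0` records that no logarithm
  -- is lost.
  refine ⟨20, 1 / 8, 1 / 8, 0, by norm_num, by norm_num, by norm_num, ?_⟩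
  intro D O _ _ _ _ _ ℳ c hc T hT 𝒜 h𝒜 alg R hR halg
  have hT0 : 0 < T := by omega
  have hT' : (T : ℝ) ≠ 0 := by exact_mod_cast hT0.ne'
  have hsup := iSup₂_le fun (γ : ℝ) (hγ : √(2 * DMSO.logFactor c ℳ T * T) < γ) =>
    DMSO.locDec_convHull_le hT0 h𝒜 hR halg (DMSO.logFactor_ge hc ℳ hT) hγ
  refine EReal.sub_le_of_le_add ?_
  have h1 := mul_le_mul_of_nonneg_left hsup
    (by rw [EReal.coe_nonneg]; norm_num : (0 : EReal) ≤ ((1 / 8 / Real.log T ^ 0 : ℝ) : EReal))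
  have h2 := mul_le_mul_of_nonneg_right h1
    (by rw [EReal.coe_nonneg]; positivity : (0 : EReal) ≤ ((T : ℝ) : EReal))
  refine h2.trans (le_of_eq ?_)
  rw [← EReal.coe_mul, ← EReal.coe_mul, ← EReal.coe_add]
  congr 1
  field_simp
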